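/- Conventions. C*-algebras are complex and not assumed unital. A \emph{minimal projection} of a C*-algebra $\mathcal B$ is a nonzero projection $p\in\mathcal B$ with $p\mathcal Bp=\mathbb C p$. A C*-algebra is \emph{scattered} if each of its nonzero *-homomorphic images (equivalently, each nonzero quotient by a closed two-sided ideal) has a minimal projection. A \emph{hereditary C*-subalgebra} of $\mathcal A$ is a norm-closed *-subalgebra $\mathcal B$ such that $a\in\mathcal A$, $b\in\mathcal B$ and $0\le a\le b$ imply $a\in\mathcal B$. A set $\mathcal X$ of self-adjoint elements of $\mathcal A$ is \emph{h-irredundant} if no $a\in\mathcal X$ belongs to the hereditary C*-subalgebra of $\mathcal A$ generated by $\mathcal X\setminus\{a\}$. A \emph{state} of $\mathcal A$ is a positive linear functional of norm one, and a \emph{pure state} is an extreme point of the set of all states. A \emph{positive biorthogonal system} in $\mathcal A$ is a family $(a_\alpha,\tau_\alpha)_{\alpha<\kappa}$ of positive elements $a_\alpha\in\mathcal A$ and positive linear functionals $\tau_\alpha$ on $\mathcal A$ such that $\tau_\alpha(a_\alpha)=1$ for every $\alpha<\kappa$ and $\tau_\alpha(a_\beta)=0$ for all $\alpha\ne\beta$.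 Corollary. Let $\mathcal A$ be a scattered C*-algebra and let $\kappa$ be a cardinal. Then $\mathcal A$ has an h-irredundant set of cardinality $\kappa$ if and only if $\mathcal A$ has a positive biorthogonal system $(a_\alpha,\tau_\alpha)_{\alpha<\kappa}$ such that $\tau_\alpha$ is a pure state for each $\alpha<\kappa$. -/

import Mathlib

open scoped ComplexOrder

universe u

/-- A minimal projection of a C*-algebra `B`: a nonzero projection `p` with `p B p = ℂ p`. -/
structure IsMinimalProjection {B : Type*} [NonUnitalCStarAlgebra B] (p : B) : Prop where
  isStarProjection : IsStarProjection p
  ne_zero : p ≠ 0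
  corner : ∀ b : B, ∃ c : ℂ, p * b * p = c • p

/-- A C*-algebra is scattered if each of its nonzero *-homomorphic images (equivalently, each
nonzero quotient by a closed ideal) has a minimal projection. A *-homomorphic image of `A` has at
most the cardinality of `A`, so that it is enough to look at images in the universe of `A`. -/
def IsScatteredCStar (A : Type u) [NonUnitalCStarAlgebra A] : Prop :=
  ∀ (B : Type u) [NonUnitalCStarAlgebra B] [Nontrivial B] (φ : A →⋆ₙₐ[ℂ] B),
    Function.Surjective φ → ∃ p : B, IsMinimalProjection p

section

variable {A : Type*} [NonUnitalCStarAlgebra A] [PartialOrder A]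

/-- A hereditary C*-subalgebra: a norm-closed *-subalgebra `B` such that `0 ≤ a ≤ b` and `b ∈ B`
imply `a ∈ B`. -/
structure IsHereditaryCStarSubalgebra (B : NonUnitalStarSubalgebra ℂ A) : Prop where
  isClosed : IsClosed (B : Set A)
  mem_of_le : ∀ a b : A, 0 ≤ a → a ≤ b → b ∈ B → a ∈ B

/-- The hereditary C*-subalgebra generated by `S`: the smallest one that contains `S`. -/
def hereditaryAdjoin (S : Set A) : NonUnitalStarSubalgebra ℂ A :=
  sInf {B | IsHereditaryCStarSubalgebra B ∧ S ⊆ B}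

theorem mem_hereditaryAdjoin {S : Set A} {a : A} :
    a ∈ hereditaryAdjoin S ↔
      ∀ B : NonUnitalStarSubalgebra ℂ A, IsHereditaryCStarSubalgebra B → S ⊆ B → a ∈ B := by
  simp [hereditaryAdjoin, NonUnitalStarAlgebra.mem_sInf]

theorem subset_hereditaryAdjoin (S : Set A) : S ⊆ hereditaryAdjoin S :=
  fun _ ha => mem_hereditaryAdjoin.2 fun _ _ hS => hS ha

theorem isHereditaryCStarSubalgebra_hereditaryAdjoin (S : Set A) :
    IsHereditaryCStarSubalgebra (hereditaryAdjoin S) where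
  isClosed := by
    simp only [hereditaryAdjoin, NonUnitalStarAlgebra.coe_sInf]
    exact isClosed_biInter fun B hB => hB.1.isClosed
  mem_of_le a b h0 hab hb := mem_hereditaryAdjoin.2 fun B hB hS =>
    hB.mem_of_le a b h0 hab (mem_hereditaryAdjoin.1 hb B hB hS)

/-- A set of self-adjoint elements is h-irredundant if none of its elements belongs to the
hereditary C*-subalgebra generated by the other ones. -/
def IsHIrredundant (X : Set A) : Prop :=
  (∀ a ∈ X, IsSelfAdjoint a) ∧ ∀ a ∈ X, a ∉ hereditaryAdjoin (X \ {a})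

/-- A positive linear functional takes nonnegative real values on positive elements. -/
def IsPositiveFunctional (τ : StrongDual ℂ A) : Prop :=
  ∀ a : A, 0 ≤ a → 0 ≤ τ a

variable (A) in
/-- The states of `A`: the positive linear functionals of norm one. -/
def cstarStates : Set (StrongDual ℂ A) :=
  {τ | IsPositiveFunctional τ ∧ ‖τ‖ = 1}

/-- The pure states are the extreme points of the set of states. -/
def IsPureState (τ : StrongDual ℂ A) : Prop :=
  τ ∈ Set.extremePoints ℝ (cstarStates A)

/-- A positive biorthogonal system: positive elements `a i` and positive functionals `τ i` with
`τ i (a i) = 1` and `τ i (a j) = 0` for `i ≠ j`. -/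
structure IsPositiveBiorthogonalSystem {ι : Type*} (a : ι → A) (τ : ι → StrongDual ℂ A) :
    Prop where
  nonneg : ∀ i, 0 ≤ a i
  positive : ∀ i, IsPositiveFunctional (τ i)
  apply_self : ∀ i, τ i (a i) = 1
  apply_of_ne : ∀ i j, i ≠ j → τ i (a j) = 0

end

/-! Both conditions say that positive functionals separate each element from the rest. If a
self-adjoint `a` lies outside a hereditary subalgebra `B`, then `a * a` lies outside the closed cone
of elements dominated by `B₊` (`mem_of_forall_mul_self_le`). Hahn–Banach gives a positive functional
killing `B₊` but not `a * a`, and Krein–Milman on a face makes it a pure state; the normalised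
squares form the system. Conversely, the null subalgebra of `τ i` is hereditary and contains every
`a j` with `j ≠ i`, but not `a i`. -/

section

/-! ### Approximate units and membership in hereditary subalgebras. -/

variable {A : Type*} [NonUnitalCStarAlgebra A]

/-- Formally, `compress e y = (1 - e) * y * (1 - e)`. -/
def compress (e y : A) : A := y - e * y - y * e + e * y * e

theorem compress_add (e x y : A) : compress e (x + y) = compress e x + compress e y := by
  simp only [compress, mul_add, add_mul]; abel

theorem compress_sub (e x y : A) : compress e (x - y) = compress e x - compress e y := by
  simp only [compress, mul_sub, sub_mul]; abel

theorem compress_star_mul_self {e : A} (he : IsSelfAdjoint e) (z : A) :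
    compress e (star z * z) = star (z - z * e) * (z - z * e) := by
  simp only [compress, star_sub, star_mul, he.star_eq, sub_mul, mul_sub, mul_assoc]; abel

theorem norm_compress_le {e : A} (he : ‖e‖ ≤ 1) (y : A) : ‖compress e y‖ ≤ 4 * ‖y‖ := by
  have h1 : ‖e * y‖ ≤ ‖y‖ := (norm_mul_le _ _).trans (mul_le_of_le_one_left (norm_nonneg _) he)
  have h2 : ‖y * e‖ ≤ ‖y‖ := (norm_mul_le _ _).trans (mul_le_of_le_one_right (norm_nonneg _) he)
  have h3 : ‖e * y * e‖ ≤ ‖y‖ :=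
    (norm_mul_le _ _).trans ((mul_le_of_le_one_right (norm_nonneg _) he).trans h1)
  have h4 := norm_add_le (y - e * y - y * e) (e * y * e)
  have h5 := norm_sub_le (y - e * y) (y * e)
  have h6 := norm_sub_le y (e * y)
  unfold compress
  linarith

theorem NonUnitalStarSubalgebra.real_smul_mem (B : NonUnitalStarSubalgebra ℂ A) {b : A}
    (hb : b ∈ B) (r : ℝ) : r • b ∈ B := by
  rw [← Complex.coe_smul]
  exact SMulMemClass.smul_mem _ hb

variable [PartialOrder A] [StarOrderedRing A]

theorem compress_nonneg {e y : A} (he : IsSelfAdjoint e) (hy : 0 ≤ y) : 0 ≤ compress e y := by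
  obtain ⟨z, rfl⟩ := CStarAlgebra.nonneg_iff_eq_star_mul_self.1 hy
  rw [compress_star_mul_self he]
  exact star_mul_self_nonneg _

theorem compress_mono {e x y : A} (he : IsSelfAdjoint e) (hxy : x ≤ y) :
    compress e x ≤ compress e y := by
  rw [← sub_nonneg, ← compress_sub]
  exact compress_nonneg he (sub_nonneg.2 hxy)

/-- A nonnegative element `b` has a local approximate unit dominated by a multiple of `b`. -/
theorem exists_norm_compress_le {b : A} (hb : 0 ≤ b) {δ : ℝ} (hδ : 0 < δ) :
    ∃ e : A, 0 ≤ e ∧ e ≤ δ⁻¹ • b ∧ ‖e‖ ≤ 1 ∧ ‖compress e b‖ ≤ δ := by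
  have hsa : IsSelfAdjoint b := hb.isSelfAdjoint
  have hpos : ∀ t : ℝ, 0 < |t| + δ := fun t => by positivity
  have hcont : Continuous fun t : ℝ => |t| / (|t| + δ) :=
    continuous_abs.div (by fun_prop) fun t => (hpos t).ne'
  -- On the spectrum this is `t / (t + δ)`; the absolute value only keeps the denominator positive
  -- on all of `ℝ`.
  refine ⟨cfcₙ (fun t : ℝ => |t| / (|t| + δ)) b, ?_, ?_, ?_, ?_⟩
  · exact cfcₙ_nonneg fun t _ => by positivity
  · rw [← cfcₙ_const_mul_id δ⁻¹ b]
    refine cfcₙ_mono ?_ hcont.continuousOn (by fun_prop) (by simp) (by simp)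
    intro t ht
    have ht0 : 0 ≤ t := quasispectrum_nonneg_of_nonneg b hb t ht
    rw [abs_of_nonneg ht0, div_eq_inv_mul]
    gcongr
    linarith
  · refine norm_cfcₙ_le fun t _ => ?_
    rw [Real.norm_of_nonneg (by positivity)]
    exact (div_le_one (hpos t)).2 (by linarith)
  · have key : compress (cfcₙ (fun t : ℝ => |t| / (|t| + δ)) b) b =
        cfcₙ (fun t : ℝ => t - |t| / (|t| + δ) * t - t * (|t| / (|t| + δ)) +
          |t| / (|t| + δ) * t * (|t| / (|t| + δ))) b := by
      have hc := hcont.continuousOn (s := quasispectrum ℝ b)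
      rw [cfcₙ_add .., cfcₙ_sub .., cfcₙ_sub .., cfcₙ_mul .., cfcₙ_mul .., cfcₙ_mul ..,
        cfcₙ_mul .., cfcₙ_id' ℝ b, compress]
    rw [key]
    refine norm_cfcₙ_le fun t ht => ?_
    have ht0 : 0 ≤ t := quasispectrum_nonneg_of_nonneg b hb t ht
    have h := hpos t
    rw [abs_of_nonneg ht0] at h ⊢
    have h' : t - t / (t + δ) * t - t * (t / (t + δ)) + t / (t + δ) * t * (t / (t + δ)) =
        t * δ ^ 2 / (t + δ) ^ 2 := by
      field_simp; ring
    rw [h', Real.norm_of_nonneg (by positivity), div_le_iff₀ (by positivity)]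
    nlinarith [mul_nonneg ht0 hδ.le, mul_nonneg (mul_nonneg ht0 ht0) hδ.le, pow_pos hδ 3]

namespace IsHereditaryCStarSubalgebra

variable {B : NonUnitalStarSubalgebra ℂ A}

/-- Since `e * a * e` lies between `±‖a‖ • (e * e)`, a shift by `‖a‖ • (e * e)` reduces to the
positive case. -/
theorem conjugate_mem (hB : IsHereditaryCStarSubalgebra B) {a e : A} (ha : IsSelfAdjoint a)
    (he : IsSelfAdjoint e) (heB : e ∈ B) : e * a * e ∈ B := by
  have hB2 : ‖a‖ • (e * e) ∈ B := B.real_smul_mem (B.mul_mem heB heB) _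
  have h1 : e * a * e ≤ ‖a‖ • (e * e) := by
    simpa [he.star_eq] using CStarAlgebra.star_left_conjugate_le_norm_smul (a := e) ha
  have h2 : -(e * a * e) ≤ ‖a‖ • (e * e) := by
    simpa [he.star_eq] using CStarAlgebra.star_left_conjugate_le_norm_smul (a := e) ha.neg
  have h3 : e * a * e + ‖a‖ • (e * e) ∈ B := by
    refine hB.mem_of_le _ (‖a‖ • (e * e) + ‖a‖ • (e * e)) ?_ (by gcongr) (B.add_mem hB2 hB2)
    exact neg_le_iff_add_nonneg'.1 h2
  simpa using B.sub_mem h3 hB2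

/-- A local unit `e ∈ B` for `b` satisfies `‖a - a * e‖ ^ 2 = ‖compress e (a * a)‖`, which is small,
so `a` is a limit of elements `e * a * e` of `B`. -/
theorem mem_of_forall_mul_self_le (hB : IsHereditaryCStarSubalgebra B) {a : A}
    (ha : IsSelfAdjoint a)
    (h : ∀ ε > 0, ∃ b ∈ B, 0 ≤ b ∧ ∃ y : A, a * a ≤ b + y ∧ ‖y‖ < ε) : a ∈ B := by
  have haB : a ∈ closure (B : Set A) := by
    refine Metric.mem_closure_iff.2 fun ε hε => ?_
    -- Compression costs a factor 4, so `y` contributes less than half of `(ε / 2) ^ 2` and `b` at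
    -- most a quarter.
    obtain ⟨b, hbB, hb, y, hy, hyε⟩ := h ((ε / 2) ^ 2 / 8) (by positivity)
    obtain ⟨e, he, heb, he1, hc⟩ :=
      exists_norm_compress_le hb (δ := (ε / 2) ^ 2 / 4) (by positivity)
    have hes : IsSelfAdjoint e := he.isSelfAdjoint
    have heB : e ∈ B := hB.mem_of_le _ _ he heb (B.real_smul_mem hbB _)
    refine ⟨e * a * e, hB.conjugate_mem ha hes heB, ?_⟩
    have h1 : ‖a - a * e‖ * ‖a - a * e‖ < (ε / 2) ^ 2 := by
      rw [← CStarRing.norm_star_mul_self, ← compress_star_mul_self hes, ha.star_eq]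
      have h2 : ‖compress e (a * a)‖ ≤ ‖compress e b + compress e y‖ := by
        refine CStarAlgebra.norm_le_norm_of_nonneg_of_le (compress_nonneg hes ?_) ?_
        · simpa [ha.star_eq] using star_mul_self_nonneg a
        · rw [← compress_add]
          exact compress_mono hes hy
      have h3 := norm_add_le (compress e b) (compress e y)
      have h4 := norm_compress_le he1 y
      have h5 : 0 < (ε / 2) ^ 2 := by positivity
      linarith
    have h2 : ‖a - a * e‖ < ε / 2 := by
      refine lt_of_pow_lt_pow_left₀ 2 (by positivity) ?_
      rwa [sq ‖a - a * e‖]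
    have h3 : ‖a - e * a‖ = ‖a - a * e‖ := by
      rw [← norm_star (a - a * e)]
      simp [ha.star_eq, hes.star_eq]
    have h4 : a - e * a * e = (a - a * e) + (a - e * a) * e := by
      simp only [sub_mul]; abel
    have h5 : ‖(a - e * a) * e‖ ≤ ‖a - e * a‖ :=
      (norm_mul_le _ _).trans (mul_le_of_le_one_right (norm_nonneg _) he1)
    rw [dist_eq_norm, h4]
    have h6 := norm_add_le (a - a * e) ((a - e * a) * e)
    linarith
  rwa [hB.isClosed.closure_eq] at haB

end IsHereditaryCStarSubalgebra

end

/-! ### Separation by positive functionals and pure states. -/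

section

variable {A : Type*} [NonUnitalCStarAlgebra A] [PartialOrder A]

theorem exists_isPureState_of_isPositiveFunctional {S : Set A} (hS : ∀ b ∈ S, 0 ≤ b) {c : A}
    {τ₀ : StrongDual ℂ A} (hτ₀ : IsPositiveFunctional τ₀) (hτ₀S : ∀ b ∈ S, τ₀ b = 0)
    (hτ₀c : 0 < (τ₀ c).re) :
    ∃ τ : StrongDual ℂ A, IsPureState τ ∧ (∀ b ∈ S, τ b = 0) ∧ 0 < (τ c).re := by
  -- Norm at most one, not equal to one, for weak-* compactness. Vanishing on positive elements and
  -- then maximising at `c` each cut out a face, so extreme points remain extreme in the positive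
  -- unit ball.
  let K : Set (WeakDual ℂ A) := {τ | ‖WeakDual.toStrongDual τ‖ ≤ 1 ∧ (∀ a, 0 ≤ a → 0 ≤ τ a) ∧
    ∀ b ∈ S, τ b = 0}
  have hev : ∀ a : A, Continuous fun τ : WeakDual ℂ A => τ a := WeakDual.eval_continuous
  have hK : IsCompact K := by
    have h1 : IsClosed {τ : WeakDual ℂ A | (∀ a, 0 ≤ a → 0 ≤ τ a) ∧ ∀ b ∈ S, τ b = 0} := by
      simp only [Set.ofPred_and, Set.ofPred_forall]
      exact (isClosed_iInter fun a => isClosed_iInter fun _ =>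
        isClosed_le continuous_const (hev a)).inter
          (isClosed_iInter fun b => isClosed_iInter fun _ => isClosed_eq (hev b) continuous_const)
    convert (WeakDual.isCompact_closedBall (𝕜 := ℂ) (0 : StrongDual ℂ A) 1).inter_right h1
      using 1
    ext τ
    simp [K]
  have hτ₀n : 0 < ‖τ₀‖ := by
    refine norm_pos_iff.2 ?_
    rintro rfl
    simp at hτ₀c
  let σ : WeakDual ℂ A := StrongDual.toWeakDual ((‖τ₀‖⁻¹ : ℝ) • τ₀)
  have hσ : ∀ x, σ x = (‖τ₀‖⁻¹ : ℝ) • τ₀ x := fun x => rfl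
  have hσK : σ ∈ K := by
    refine ⟨?_, fun a ha => ?_, fun b hb => ?_⟩
    · change ‖(‖τ₀‖⁻¹ : ℝ) • τ₀‖ ≤ 1
      rw [norm_smul, norm_inv, norm_norm, inv_mul_cancel₀ hτ₀n.ne']
    · rw [hσ]
      exact smul_nonneg (by positivity) (hτ₀ a ha)
    · rw [hσ, hτ₀S b hb, smul_zero]
  have hre : Continuous fun τ : WeakDual ℂ A => (τ c).re := Complex.continuous_re.comp (hev c)
  obtain ⟨μ, hμK, hμ⟩ := hK.exists_isMaxOn ⟨σ, hσK⟩ hre.continuousOn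
  have hμpos : 0 < (μ c).re := by
    refine lt_of_lt_of_le ?_ (hμ hσK)
    simp only [hσ, Complex.smul_re, smul_eq_mul]
    positivity
  have : IsScalarTower ℝ ℂ (WeakDual ℂ A) :=
    inferInstanceAs (IsScalarTower ℝ ℂ (StrongDual ℂ A))
  have : LocallyConvexSpace ℝ (WeakDual ℂ A) :=
    (WeakDual.withSeminorms ℂ A).toLocallyConvexSpace
  obtain ⟨τ, hτ⟩ := (hK.inter_right (isClosed_le (continuous_const (y := (μ c).re)) hre)
    ).extremePoints_nonempty ⟨μ, hμK, le_refl (μ c).re⟩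
  obtain ⟨⟨⟨hτn, hτpos, hτS⟩, hτc⟩, hext⟩ := mem_extremePoints_iff_left.1 hτ
  have hτc' : 0 < (τ c).re := hμpos.trans_le hτc
  -- `τ` is extreme among the positive functionals of norm at most one.
  have key : ∀ τ₁ τ₂ : StrongDual ℂ A, IsPositiveFunctional τ₁ → ‖τ₁‖ ≤ 1 →
      IsPositiveFunctional τ₂ → ‖τ₂‖ ≤ 1 → WeakDual.toStrongDual τ ∈ openSegment ℝ τ₁ τ₂ →
      τ₁ = WeakDual.toStrongDual τ := by
    rintro τ₁ τ₂ h₁ hn₁ h₂ hn₂ ⟨s, t, hs, ht, hst, h⟩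
    have happ : ∀ x, s • τ₁ x + t • τ₂ x = τ x := fun x => DFunLike.congr_fun h x
    have hvan : ∀ b ∈ S, τ₁ b = 0 ∧ τ₂ b = 0 := by
      intro b hb
      have h := happ b
      rw [hτS b hb, add_eq_zero_iff_of_nonneg (smul_nonneg hs.le (h₁ b (hS b hb)))
        (smul_nonneg ht.le (h₂ b (hS b hb)))] at h
      simpa [hs.ne', ht.ne'] using h
    have hK₁ : StrongDual.toWeakDual τ₁ ∈ K := ⟨hn₁, h₁, fun b hb => (hvan b hb).1⟩
    have hK₂ : StrongDual.toWeakDual τ₂ ∈ K := ⟨hn₂, h₂, fun b hb => (hvan b hb).2⟩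
    have hm₁ : (τ₁ c).re ≤ (μ c).re := hμ hK₁
    have hm₂ : (τ₂ c).re ≤ (μ c).re := hμ hK₂
    have hc : s * (τ₁ c).re + t * (τ₂ c).re = (τ c).re := by
      simpa using congrArg Complex.re (happ c)
    have hτc'' : (μ c).re ≤ (τ c).re := hτc
    have e₁ : (μ c).re ≤ (τ₁ c).re := by
      have : t * (τ₂ c).re ≤ t * (μ c).re := by gcongr
      have : (s + t) * (μ c).re = (μ c).re := by rw [hst, one_mul]
      refine le_of_mul_le_mul_left ?_ hs
      linarith
    have e₂ : (μ c).re ≤ (τ₂ c).re := by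
      have : s * (τ₁ c).re ≤ s * (μ c).re := by gcongr
      have : (s + t) * (μ c).re = (μ c).re := by rw [hst, one_mul]
      refine le_of_mul_le_mul_left ?_ ht
      linarith
    exact hext (StrongDual.toWeakDual τ₁) ⟨hK₁, e₁⟩ (StrongDual.toWeakDual τ₂) ⟨hK₂, e₂⟩
      ⟨s, t, hs, ht, hst, h⟩
  refine ⟨WeakDual.toStrongDual τ, mem_extremePoints_iff_left.2 ⟨⟨hτpos, ?_⟩, ?_⟩, hτS, hτc'⟩
  · set τ' : StrongDual ℂ A := WeakDual.toStrongDual τ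
    have hτ'n : 0 < ‖τ'‖ := by
      refine norm_pos_iff.2 fun h0 => ?_
      have : τ' c = τ c := rfl
      rw [← this, h0] at hτc'
      simp at hτc'
    -- If the norm were below one, `τ'` would lie strictly between `0` and its normalisation.
    by_contra hne
    have hlt : ‖τ'‖ < 1 := lt_of_le_of_ne hτn hne
    have h1 : ‖τ'‖ • ((‖τ'‖⁻¹ : ℝ) • τ') = τ' := by
      rw [smul_smul, mul_inv_cancel₀ hτ'n.ne', one_smul]
    have hn : ‖(‖τ'‖⁻¹ : ℝ) • τ'‖ = 1 := by
      rw [norm_smul, norm_inv, norm_norm, inv_mul_cancel₀ hτ'n.ne']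
    have hpos : IsPositiveFunctional ((‖τ'‖⁻¹ : ℝ) • τ') := fun a ha =>
      smul_nonneg (inv_nonneg.2 (norm_nonneg τ')) (hτpos a ha)
    have hzero : (1 - ‖τ'‖) • (0 : StrongDual ℂ A) = 0 := by ext; simp
    have h2 := key _ 0 hpos hn.le (fun a _ => le_rfl) (by simp)
      ⟨‖τ'‖, 1 - ‖τ'‖, hτ'n, sub_pos.2 hlt, by ring, by rw [h1, hzero, add_zero]⟩
    exact hne (by rw [← h2, hn])
  · exact fun τ₁ h₁ τ₂ h₂ h => key τ₁ τ₂ h₁.1 h₁.2.le h₂.1 h₂.2.le h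

variable [StarOrderedRing A] {B : NonUnitalStarSubalgebra ℂ A}

/-- A positive functional that separates `a * a` from a hereditary subalgebra without `a`. -/
theorem IsHereditaryCStarSubalgebra.exists_isPositiveFunctional
    (hB : IsHereditaryCStarSubalgebra B) {a : A} (ha : IsSelfAdjoint a) (haB : a ∉ B) :
    ∃ τ : StrongDual ℂ A, IsPositiveFunctional τ ∧ (∀ b ∈ B, 0 ≤ b → τ b = 0) ∧
      0 < (τ (a * a)).re := by
  -- This cone contains `-A₊` and `B₊`, so a functional that is nonpositive on it is positive and
  -- kills `B₊`.
  let C : Set A := {x | ∃ b ∈ B, 0 ≤ b ∧ x ≤ b}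
  have hCsmul : ∀ x ∈ C, ∀ r : ℝ, 0 ≤ r → r • x ∈ C := by
    rintro x ⟨b, hb, hb0, hx⟩ r hr
    exact ⟨r • b, B.real_smul_mem hb r, smul_nonneg hr hb0, smul_le_smul_of_nonneg_left hx hr⟩
  have hCadd : ∀ x ∈ C, ∀ y ∈ C, x + y ∈ C := by
    rintro x ⟨b, hb, hb0, hx⟩ y ⟨d, hd, hd0, hy⟩
    exact ⟨b + d, B.add_mem hb hd, add_nonneg hb0 hd0, add_le_add hx hy⟩
  have hCconv : Convex ℝ C := fun x hx y hy s t hs ht _ =>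
    hCadd _ (hCsmul x hx s hs) _ (hCsmul y hy t ht)
  have hnot : a * a ∉ closure C := by
    refine fun hcl => haB (hB.mem_of_forall_mul_self_le ha fun ε hε => ?_)
    obtain ⟨x, ⟨b, hb, hb0, hx⟩, hd⟩ := Metric.mem_closure_iff.1 hcl ε hε
    refine ⟨b, hb, hb0, a * a - x, ?_, by rwa [← dist_eq_norm]⟩
    rw [← sub_nonneg] at hx ⊢
    convert hx using 1
    abel
  obtain ⟨f, u, hf, hu⟩ :=
    geometric_hahn_banach_closed_point hCconv.closure isClosed_closure hnot
  have hfC : ∀ x ∈ C, f x ≤ 0 := by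
    intro x hx
    by_contra! hpos
    obtain ⟨n, hn⟩ := exists_nat_gt (u / f x)
    have h1 := hf _ (subset_closure (hCsmul x hx n n.cast_nonneg))
    rw [map_smul, smul_eq_mul] at h1
    rw [div_lt_iff₀ hpos] at hn
    linarith
  have hu0 : 0 < u := by
    simpa using hf 0 (subset_closure ⟨0, B.zero_mem, le_rfl, le_rfl⟩)
  have hfpos : ∀ x : A, 0 ≤ x → 0 ≤ f x := fun x hx => by
    simpa using hfC (-x) ⟨0, B.zero_mem, le_rfl, neg_nonpos.2 hx⟩
  have hfB : ∀ b ∈ B, 0 ≤ b → f b = 0 := fun b hb hb0 =>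
    le_antisymm (hfC b ⟨b, hb, hb0, le_rfl⟩) (hfpos b hb0)
  -- Symmetrising kills skew-adjoint elements, so the complex extension is real on self-adjoint
  -- ones.
  let g : StrongDual ℝ A := f + f.comp (starL' ℝ : A ≃L[ℝ] A).toContinuousLinearMap
  let τ : StrongDual ℂ A := g.extendRCLike
  have hg : ∀ x : A, g x = f x + f (star x) := fun x => rfl
  have hτ : ∀ x : A, IsSelfAdjoint x → τ x = ((2 * f x : ℝ) : ℂ) := by
    intro x hx
    have hI : g (Complex.I • x) = 0 := by
      rw [hg, star_smul, hx.star_eq]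
      simp
    have h1 : τ x = (g x : ℂ) - Complex.I * (g (Complex.I • x) : ℂ) :=
      StrongDual.extendRCLike_apply g x
    rw [h1, hI, hg, hx.star_eq, two_mul]
    simp
  refine ⟨τ, fun x hx => ?_, fun b hb hb0 => ?_, ?_⟩
  · rw [hτ x hx.isSelfAdjoint, Complex.zero_le_real]
    exact mul_nonneg zero_le_two (hfpos x hx)
  · rw [hτ b hb0.isSelfAdjoint, hfB b hb hb0]
    simp
  · have haa : IsSelfAdjoint (a * a) := by simpa [ha.star_eq] using IsSelfAdjoint.star_mul_self a
    rw [hτ _ haa, Complex.ofReal_re]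
    linarith

theorem IsHereditaryCStarSubalgebra.exists_isPureState
    (hB : IsHereditaryCStarSubalgebra B) {a : A} (ha : IsSelfAdjoint a) (haB : a ∉ B) :
    ∃ τ : StrongDual ℂ A, IsPureState τ ∧ (∀ b ∈ B, 0 ≤ b → τ b = 0) ∧
      0 < (τ (a * a)).re := by
  obtain ⟨τ₀, h1, h2, h3⟩ := hB.exists_isPositiveFunctional ha haB
  obtain ⟨τ, h4, h5, h6⟩ := exists_isPureState_of_isPositiveFunctional
    (S := {b | b ∈ B ∧ 0 ≤ b}) (fun b hb => hb.2) h1 (fun b hb => h2 b hb.1 hb.2) h3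
  exact ⟨τ, h4, fun b hb hb0 => h5 b ⟨hb, hb0⟩, h6⟩

/-! ### The null subalgebra of a positive functional. -/

namespace IsPositiveFunctional

variable {τ : StrongDual ℂ A}

theorem mono (hτ : IsPositiveFunctional τ) {x y : A} (hxy : x ≤ y) : τ x ≤ τ y := by
  simpa using hτ (y - x) (sub_nonneg.2 hxy)

theorem apply_eq_zero_of_le (hτ : IsPositiveFunctional τ) {x y : A} (hx : 0 ≤ x) (hxy : x ≤ y)
    (hy : τ y = 0) : τ x = 0 :=
  le_antisymm (hy ▸ hτ.mono hxy) (hτ x hx)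

theorem mul_self_eq_zero (hτ : IsPositiveFunctional τ) {b : A} (hb : 0 ≤ b) (h : τ b = 0) :
    τ (b * b) = 0 := by
  obtain ⟨s, hs, rfl⟩ : ∃ s : A, 0 ≤ s ∧ b = s * s :=
    ⟨CFC.sqrt b, CFC.sqrt_nonneg b, (CFC.sqrt_mul_sqrt_self b).symm⟩
  refine hτ.apply_eq_zero_of_le (y := ‖s * s‖ • (s * s)) ?_ ?_ ?_
  · simpa [hb.isSelfAdjoint.star_eq] using star_mul_self_nonneg (s * s)
  · simpa [hs.isSelfAdjoint.star_eq, mul_assoc] using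
      CStarAlgebra.star_left_conjugate_le_norm_smul (a := s) hb.isSelfAdjoint
  · rw [← Complex.coe_smul, map_smul, h, smul_zero]

/-- A degenerate Cauchy–Schwarz: `τ ((k • x - y) ^ 2) ≥ 0` is affine in `k` once `τ (x * x) = 0`, so
its slope vanishes. -/
theorem apply_mul_eq_zero (hτ : IsPositiveFunctional τ) {x y : A} (hx : IsSelfAdjoint x)
    (hy : IsSelfAdjoint y) (hcomm : Commute x y) (hxy : 0 ≤ x * y) (h : τ (x * x) = 0) :
    τ (x * y) = 0 := by
  have hle : ∀ k : ℝ, k * (2 * (τ (x * y)).re) ≤ (τ (y * y)).re := by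
    intro k
    have hsa : star (k • x - y) = k • x - y := by simp [hx.star_eq, hy.star_eq]
    have h0 : 0 ≤ τ ((k • x - y) * (k • x - y)) := by
      refine hτ _ ?_
      simpa only [hsa] using star_mul_self_nonneg (k • x - y)
    have h1 : (k • x - y) * (k • x - y) =
        (k : ℂ) • ((k : ℂ) • (x * x)) - (k : ℂ) • (x * y + x * y) + y * y := by
      simp only [← Complex.coe_smul, sub_mul, mul_sub, smul_mul_assoc, mul_smul_comm, smul_add,
        smul_sub, ← hcomm.eq]
      abel
    have h2 := (Complex.nonneg_iff.1 h0).1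
    rw [h1] at h2
    simp [h] at h2
    linarith
  have hpos := hτ _ hxy
  have hre : (τ (x * y)).re = 0 := by
    refine le_antisymm ?_ (Complex.nonneg_iff.1 hpos).1
    by_contra! hlt
    obtain ⟨n, hn⟩ := exists_nat_gt ((τ (y * y)).re / (2 * (τ (x * y)).re))
    rw [div_lt_iff₀ (by positivity)] at hn
    exact (hle n).not_gt hn
  exact Complex.ext hre (Complex.nonneg_iff.1 hpos).2.symm

/-- Fourth roots let Cauchy–Schwarz lower the exponent of `b` from 2 to 3/2, then to 1. -/
theorem eq_zero_of_mul_self (hτ : IsPositiveFunctional τ) {b : A} (hb : 0 ≤ b)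
    (h : τ (b * b) = 0) : τ b = 0 := by
  obtain ⟨s, hs, rfl⟩ : ∃ s : A, 0 ≤ s ∧ b = s * s :=
    ⟨CFC.sqrt b, CFC.sqrt_nonneg b, (CFC.sqrt_mul_sqrt_self b).symm⟩
  obtain ⟨r, hr, rfl⟩ : ∃ r : A, 0 ≤ r ∧ s = r * r :=
    ⟨CFC.sqrt s, CFC.sqrt_nonneg s, (CFC.sqrt_mul_sqrt_self s).symm⟩
  have h3 : 0 ≤ r * r * (r * r) * (r * r) := conjugate_nonneg_of_nonneg hs hs
  have h6 : τ (r * r * (r * r) * (r * r)) = 0 :=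
    hτ.apply_mul_eq_zero hb.isSelfAdjoint hs.isSelfAdjoint (by simp [commute_iff_eq, mul_assoc])
      h3 h
  have h4 := hτ.apply_mul_eq_zero (x := r * r * r) (y := r)
    (conjugate_nonneg_of_nonneg hr hr).isSelfAdjoint hr.isSelfAdjoint
    (by simp [commute_iff_eq, mul_assoc]) (by simpa [mul_assoc] using hb)
    (by simpa [mul_assoc] using h6)
  simpa [mul_assoc] using h4

/-- The elements `x` for which `τ` vanishes at `star x * x` and at `x * star x`. -/
def nullSubalgebra (hτ : IsPositiveFunctional τ) : NonUnitalStarSubalgebra ℂ A where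
  carrier := {x | τ (star x * x) = 0 ∧ τ (x * star x) = 0}
  zero_mem' := by simp
  add_mem' := by
    have key : ∀ x y : A, τ (star x * x) = 0 → τ (star y * y) = 0 →
        τ (star (x + y) * (x + y)) = 0 := by
      intro x y hx hy
      refine hτ.apply_eq_zero_of_le (y := star (x + y) * (x + y) + star (x - y) * (x - y))
        (star_mul_self_nonneg _) (le_add_of_nonneg_right (star_mul_self_nonneg _)) ?_
      have : star (x + y) * (x + y) + star (x - y) * (x - y) =
          star x * x + star x * x + (star y * y + star y * y) := by
        simp only [star_add, star_sub, add_mul, mul_add, sub_mul, mul_sub]; abel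
      rw [this]
      simp [hx, hy]
    rintro x y ⟨hx, hx'⟩ ⟨hy, hy'⟩
    refine ⟨key x y hx hy, ?_⟩
    have := key (star x) (star y) (by rwa [star_star]) (by rwa [star_star])
    rwa [← star_add, star_star] at this
  mul_mem' := by
    have key : ∀ x y : A, τ (star y * y) = 0 → τ (star (x * y) * (x * y)) = 0 := by
      intro x y hy
      refine hτ.apply_eq_zero_of_le (star_mul_self_nonneg _)
        (y := ‖star x * x‖ • (star y * y)) ?_ ?_
      · simpa [mul_assoc] using
          CStarAlgebra.star_left_conjugate_le_norm_smul (a := y) (IsSelfAdjoint.star_mul_self x)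
      · rw [← Complex.coe_smul, map_smul, hy, smul_zero]
    rintro x y ⟨hx, hx'⟩ ⟨hy, hy'⟩
    refine ⟨key x y hy, ?_⟩
    have := key (star y) (star x) (by rwa [star_star])
    rwa [← star_mul, star_star] at this
  smul_mem' := by
    rintro c x ⟨hx, hx'⟩
    constructor <;> simp [smul_mul_assoc, mul_smul_comm, hx, hx']
  star_mem' := by
    rintro x ⟨hx, hx'⟩
    exact ⟨by rwa [star_star], by rwa [star_star]⟩

theorem mem_nullSubalgebra (hτ : IsPositiveFunctional τ) {x : A} :
    x ∈ hτ.nullSubalgebra ↔ τ (star x * x) = 0 ∧ τ (x * star x) = 0 := Iff.rfl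

theorem mem_nullSubalgebra_of_isSelfAdjoint (hτ : IsPositiveFunctional τ) {x : A}
    (hx : IsSelfAdjoint x) : x ∈ hτ.nullSubalgebra ↔ τ (x * x) = 0 := by
  rw [mem_nullSubalgebra, hx.star_eq, and_self]

theorem isHereditaryCStarSubalgebra_nullSubalgebra (hτ : IsPositiveFunctional τ) :
    IsHereditaryCStarSubalgebra hτ.nullSubalgebra where
  isClosed := by
    refine (isClosed_eq (f := fun x : A => τ (star x * x)) (by fun_prop) continuous_const).inter
      (isClosed_eq (f := fun x : A => τ (x * star x)) (by fun_prop) continuous_const)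
  mem_of_le a b ha hab hb := by
    rw [mem_nullSubalgebra_of_isSelfAdjoint hτ (ha.trans hab).isSelfAdjoint] at hb
    rw [mem_nullSubalgebra_of_isSelfAdjoint hτ ha.isSelfAdjoint]
    -- Squaring is not operator monotone, so the comparison is made between first powers.
    exact hτ.mul_self_eq_zero ha
      (hτ.apply_eq_zero_of_le ha hab (hτ.eq_zero_of_mul_self (ha.trans hab) hb))

end IsPositiveFunctional

end

/-! ### The equivalence. -/

theorem mainTheorem9 {A : Type u} [NonUnitalCStarAlgebra A] [PartialOrder A] [StarOrderedRing A]
    (hA : IsScatteredCStar A) (κ : Cardinal.{u}) :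
    (∃ X : Set A, IsHIrredundant X ∧ Cardinal.mk X = κ) ↔
      ∃ (a : Set.Iio κ.ord → A) (τ : Set.Iio κ.ord → StrongDual ℂ A),
        IsPositiveBiorthogonalSystem a τ ∧ ∀ α, IsPureState (τ α) := by
  have hcard : Cardinal.mk (Set.Iio κ.ord) = Cardinal.lift.{u + 1} κ := by
    rw [Cardinal.mk_Iio_ordinal, Cardinal.card_ord]
  constructor
  · rintro ⟨X, ⟨hXsa, hX⟩, hXκ⟩
    obtain ⟨e⟩ : Nonempty (Set.Iio κ.ord ≃ X) := by
      refine Cardinal.lift_mk_eq'.1 ?_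
      rw [hcard, hXκ, Cardinal.lift_lift]
    choose τ hτpure hτzero hτpos using fun i : Set.Iio κ.ord =>
      (isHereditaryCStarSubalgebra_hereditaryAdjoin (X \ {(e i : A)})).exists_isPureState
        (hXsa _ (e i).2) (hX _ (e i).2)
    have hnn : ∀ i, 0 ≤ (e i : A) * e i := fun i => by
      simpa [(hXsa _ (e i).2).star_eq] using star_mul_self_nonneg (e i : A)
    have hval : ∀ i, τ i ((e i : A) * e i) = ((τ i ((e i : A) * e i)).re : ℂ) := fun i =>
      Complex.eq_re_of_ofReal_le ((hτpure i).1.1 _ (hnn i))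
    refine ⟨fun i => ((τ i ((e i : A) * e i)).re)⁻¹ • ((e i : A) * e i), τ,
      ⟨fun i => smul_nonneg (inv_nonneg.2 (hτpos i).le) (hnn i), fun i => (hτpure i).1.1,
        fun i => ?_, fun i j hij => ?_⟩, hτpure⟩
    · rw [← Complex.coe_smul, map_smul, smul_eq_mul]
      nth_rw 2 [hval i]
      rw [← Complex.ofReal_mul, inv_mul_cancel₀ (hτpos i).ne', Complex.ofReal_one]
    · have hmem : (e j : A) ∈ X \ {(e i : A)} :=
        ⟨(e j).2, fun h => hij (e.injective (Subtype.ext h.symm))⟩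
      have hmem' := subset_hereditaryAdjoin _ hmem
      rw [← Complex.coe_smul, map_smul,
        hτzero i _ (mul_mem hmem' hmem') (hnn j), smul_zero]
  · rintro ⟨a, τ, h, -⟩
    have hinj : Function.Injective a := by
      intro i j hij
      by_contra hne
      have h1 := h.apply_of_ne i j hne
      rw [← hij, h.apply_self i] at h1
      exact one_ne_zero h1
    refine ⟨Set.range a, ⟨?_, ?_⟩, ?_⟩
    · rintro _ ⟨i, rfl⟩
      exact (h.nonneg i).isSelfAdjoint
    · rintro _ ⟨i, rfl⟩ hmem
      have hsub : Set.range a \ {a i} ⊆ (h.positive i).nullSubalgebra := by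
        rintro _ ⟨⟨j, rfl⟩, hj⟩
        have hij : i ≠ j := by
          rintro rfl
          exact hj rfl
        rw [SetLike.mem_coe, (h.positive i).mem_nullSubalgebra_of_isSelfAdjoint
          (h.nonneg j).isSelfAdjoint]
        exact (h.positive i).mul_self_eq_zero (h.nonneg j) (h.apply_of_ne i j hij)
      have h1 := mem_hereditaryAdjoin.1 hmem _
        (h.positive i).isHereditaryCStarSubalgebra_nullSubalgebra hsub
      rw [(h.positive i).mem_nullSubalgebra_of_isSelfAdjoint (h.nonneg i).isSelfAdjoint] at h1
      have h2 := (h.positive i).eq_zero_of_mul_self (h.nonneg i) h1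
      rw [h.apply_self i] at h2
      exact one_ne_zero h2
    · have h1 := Cardinal.mk_range_eq_of_injective hinj
      rw [hcard, Cardinal.lift_lift] at h1
      exact Cardinal.lift_injective h1
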